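/- \textbf{The concrete system.} Let $X\subseteq\mathbb R^{n}$ be a Borel set, $\mathcal U\subseteq\mathbb R^{m}$ a finite set, $Y$ a finite set, $f:X\times\mathcal U\to\mathbb R^{n}$ with $f(\cdot,u)$ Borel measurable for every $u\in\mathcal U$, and $h:X\to Y$ measurable. Add an absorbing state $x_{\mathrm{abs}}$ with its own output label $y_{\mathrm{abs}}$, and put $\mathcal X=X\cup\{x_{\mathrm{abs}}\}$, $\mathcal Y=Y\cup\{y_{\mathrm{abs}}\}$. Let $S_\Sigma$ be the transition system with state set $\mathcal X$, all states initial, inputs $\mathcal U$, output map $\mathcal H$ ($\mathcal H=h$ on $X$, $\mathcal H(x_{\mathrm{abs}})=y_{\mathrm{abs}}$), and exactly one $u$-successor of each state: $f(x,u)$ if $x\in X$ and $f(x,u)\in X$, and $x_{\mathrm{abs}}$ otherwise. \textbf{Behaviors.} For a transition system $S$ with initial set $\mathcal X_0$ and output map $\mathcal H_S$, let $\mathcal I_H(S)$ be the set of internal behaviors $\xi=x_0u_0x_1\dots u_{H-1}x_H$ ($x_0\in\mathcal X_0$, each $x_{i+1}$ a $u_i$-successor of $x_i$); write $\xi(k)=x_k$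 and $\mathcal H_S(\xi)=\mathcal H_S(x_0)u_0\dots u_{H-1}\mathcal H_S(x_H)$ for the external behavior of $\xi$. Let $\mathcal I_H(S,x_0,\mathbf u_H)$ be the set of those $\xi\in\mathcal I_H(S)$ that start in $x_0$ and have input sequence $\mathbf u_H$, and $\mathcal B_H(S,x_0,\mathbf u_H)$ the set of their external behaviors. For an external behavior $\gamma=y_0u_0y_1\dots u_{H-1}y_H$ and $0\le k\le H$ let $\gamma[k-\ell,k]=y_{k-\ell}u_{k-\ell}\dots u_{k-1}y_k$, where outputs and inputs at negative times are replaced by a symbol $\diamond$; such sequences are called $\ell$-sequences, and $\zeta(\ell)$ denotes the last output of an $\ell$-sequence $\zeta$. \textbf{The data-driven abstraction.} Let $0\le\ell<H$ and let $D$ be a set of external behaviors of length $H$ of $S_\Sigma$. Let $\hat\Pi_j$ be the set of all $j$-sequences $\gamma[k-j,k]$ with $\gamma\in D$, $0\le k\le H$. The abstraction $\hat S_\ell$ has state set $\hat\Pi_\ell$, output map $\mathcal H_\ell(\zeta)=\zeta(\ell)$, and as initial states the $\zeta\in\hat\Pi_\ell$ of the form $\mathcal H(\xi)[-\ell,0]$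 with $\xi\in\mathcal I_H(S_\Sigma)$ (i.e. $\diamond\cdots\diamond y$). There is a transition from $\zeta$ to $\zeta'$ under $u$ if and only if the $(\ell+1)$-sequence $\omega$ obtained by appending $u$ and $\zeta'(\ell)$ to $\zeta$ lies in $\hat\Pi_{\ell+1}$, and removing the first output and first input from $\omega$ gives $\zeta'$. Let $\hat{\mathcal R}$ be the set of pairs $(x,\zeta)\in\mathcal X\times\hat\Pi_\ell$ such that $\zeta=\mathcal H(\xi)[j-\ell,j]$ and $\xi(j)=x$ for some $\xi\in\mathcal I_H(S_\Sigma)$ and $0\le j\le H$. Let $\overline{\mathcal V}(\hat S_\ell,\hat{\mathcal R},H)$ be the set of pairs $(x,\mathbf u_H)\in\mathcal X\times\mathcal U^H$ for which there is $\xi\in\mathcal I_H(S_\Sigma,x,\mathbf u_H)$ such that no $\xi_\ell\in\bigcup_{\zeta_0}\mathcal I_H(\hat S_\ell,\zeta_0,\mathbf u_H)$, where $\zeta_0$ ranges over the initial states of $\hat S_\ell$ with $(x,\zeta_0)\in\hat{\mathcal R}$, satisfies both $\mathcal H(\xi)=\mathcal H_\ell(\xi_\ell)$ and $(\xi(k),\xi_\ell(k))\in\hat{\mathcal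 R}$ for all $0\le k\le H$. \textbf{The bound.} For $\beta\in(0,1)$ let $\epsilon(N,\beta,N)=1$ and, for integers $0\le k<N$, let $\epsilon(k,\beta,N)$ be the unique solution $\epsilon\in(0,1)$ of $$\frac{\beta}{N}\sum_{j=k}^{N-1}\binom jk(1-\epsilon)^{j-k}=\binom Nk(1-\epsilon)^{N-k}.$$ \textbf{Proposition.} Let $\mu_x$ and $\mu_{\mathbf u_H}$ be probability measures on $\mathcal X$ and $\mathcal U^H$, let $\mu_p=\mu_x\times\mu_{\mathbf u_H}$, and let $\beta\in(0,1)$. Draw $N$ i.i.d. pairs $(x^i,\mathbf u_H^i)$ from $\mu_p$, put $D=\bigcup_{i=1}^N\mathcal B_H(S_\Sigma,x^i,\mathbf u^i_H)$, construct $\hat S_\ell$ and $\hat{\mathcal R}$ from $D$, and let $s^*_{N,\ell}$ be the cardinality of a smallest subset of $D$ with the same set of witnessed $(\ell+1)$-sequences $\hat\Pi_{\ell+1}$. Then the sets below are measurable, and $$\mu_p^N\Big(\mu_p\big((x,\mathbf u_H)\in\overline{\mathcal V}(\hat S_\ell,\hat{\mathcal R},H)\big)\le\epsilon(s^*_{N,\ell},\beta,N)\Big)\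 \ge\ 1-\beta .$$ -/

import Mathlib

open MeasureTheory

/-- A transition system with state set `X`, input set `U` and output set `Y`. -/
structure TransitionSystem (X U Y : Type*) where
  /-- the set of initial states -/
  init : Set X
  /-- the transition relation: `trans x u x'` means that `x'` is a `u`-successor of `x` -/
  trans : X → U → X → Prop
  /-- the output map -/
  out : X → Y

/-- A sequence `a₀ u₀ a₁ … u_{H-1} a_H` with `a_i` in `A` and `u_i` in `U`. -/
structure Behavior (A U : Type*) (H : ℕ) where
  letter : Fin (H + 1) → A
  input : Fin H → U

namespace Behavior

variable {A B U : Type*} {H : ℕ}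

/-- Apply a map to every `a_i`; for an output map this turns an internal behavior into the
corresponding external behavior. -/
def map (g : A → B) (ξ : Behavior A U H) : Behavior B U H :=
  ⟨fun i => g (ξ.letter i), ξ.input⟩

end Behavior

/-- An `ℓ`-sequence `y₀ u₀ y₁ … u_{ℓ-1} y_ℓ`, where leading pairs `(y_i, u_i)` may be replaced by
the symbol `⋄` for "before time zero", here `none`. The last output `y_ℓ` is never `⋄`. -/
structure LSeq (Y U : Type*) (ℓ : ℕ) where
  past : Fin ℓ → Option (Y × U)
  last : Y

namespace LSeq

variable {Y U : Type*} {ℓ : ℕ}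

/-- `ζ · (ζ(ℓ) u y)`. -/
def append (ζ : LSeq Y U ℓ) (u : U) (y : Y) : LSeq Y U (ℓ + 1) :=
  ⟨Fin.snoc (α := fun _ => Option (Y × U)) ζ.past (some (ζ.last, u)), y⟩

/-- Remove the first output and the first input: `ω[1, ℓ + 1]`. -/
def tail (ω : LSeq Y U (ℓ + 1)) : LSeq Y U ℓ :=
  ⟨fun i => ω.past i.succ, ω.last⟩

end LSeq

/-- The subsequence `γ[k - ℓ, k]`, with `⋄` at negative times. -/
def Behavior.window {Y U : Type*} {H : ℕ} (γ : Behavior Y U H) (ℓ : ℕ) (k : Fin (H + 1)) :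
    LSeq Y U ℓ where
  past i :=
    if h : ℓ ≤ k.val + i.val then
      some (γ.letter ⟨k.val + i.val - ℓ, by omega⟩, γ.input ⟨k.val + i.val - ℓ, by omega⟩)
    else none
  last := γ.letter k

/-- All `ℓ`-sequences that occur in the behaviors of the set `D`. -/
def lSeqs {Y U : Type*} {H : ℕ} (ℓ : ℕ) (D : Set (Behavior Y U H)) : Set (LSeq Y U ℓ) :=
  {ζ | ∃ γ ∈ D, ∃ k : Fin (H + 1), γ.window ℓ k = ζ}

namespace TransitionSystem

variable {X Z U Y : Type*}

/-- `I_H(S)`: the internal behaviors of length `H`. -/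
def internal (S : TransitionSystem X U Y) (H : ℕ) : Set (Behavior X U H) :=
  {ξ | ξ.letter 0 ∈ S.init ∧
    ∀ i : Fin H, S.trans (ξ.letter i.castSucc) (ξ.input i) (ξ.letter i.succ)}

/-- `B_H(S)`: the external behaviors of length `H`. -/
def external (S : TransitionSystem X U Y) (H : ℕ) : Set (Behavior Y U H) :=
  {γ | ∃ ξ ∈ S.internal H, ξ.map S.out = γ}

/-- `I_H(S, x₀, u)`: the internal behaviors from `x₀` under the input sequence `u`. -/
def internalFrom (S : TransitionSystem X U Y) {H : ℕ} (x₀ : X) (u : Fin H → U) :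
    Set (Behavior X U H) :=
  {ξ | ξ ∈ S.internal H ∧ ξ.letter 0 = x₀ ∧ ξ.input = u}

/-- `B_H(S, x₀, u)`: the external behaviors from `x₀` under the input sequence `u`. -/
def externalFrom (S : TransitionSystem X U Y) {H : ℕ} (x₀ : X) (u : Fin H → U) :
    Set (Behavior Y U H) :=
  {γ | γ ∈ S.external H ∧ ∃ ξ ∈ S.internalFrom x₀ u, γ = ξ.map S.out}

/-- The corresponding external strings of length `ℓ` of the state `x`: the `ℓ`-sequences which
the system can generate up to the moment of reaching `x`. -/
def ces (S : TransitionSystem X U Y) (ℓ H : ℕ) (x : X) : Set (LSeq Y U ℓ) :=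
  {ζ | ζ ∈ lSeqs ℓ (S.external H) ∧
    ∃ ξ ∈ S.internal H, ∃ j : Fin (H + 1), ζ = (ξ.map S.out).window ℓ j ∧ ξ.letter j = x}

/-- The set `D` of the external behaviors sampled along `N` pairs (initial state, inputs). -/
def sampledBehaviors (S : TransitionSystem X U Y) {N H : ℕ} (ω : Fin N → X × (Fin H → U)) :
    Set (Behavior Y U H) :=
  ⋃ i, S.externalFrom (ω i).1 (ω i).2

/-- The data-driven `ℓ`-complete abstraction of `S` built from a set `D` of external behaviors.
The states are the `ℓ`-sequences witnessed in `D`; the initial ones are of the form `⋄ … ⋄ y`.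
The first clause of `trans` says that `ζ[1, ℓ] = ζ'[0, ℓ - 1]` and, for `ℓ ≥ 1`, that the last
input of `ζ'` is `u`; the second one that the domino `ζ · (ζ(ℓ) u ζ'(ℓ))` is witnessed in `D`. -/
def dataDriven (S : TransitionSystem X U Y) {H : ℕ} (ℓ : ℕ) (D : Set (Behavior Y U H)) :
    TransitionSystem (lSeqs ℓ D) U Y where
  init := {ζ | ∃ ξ ∈ S.internal H, (ξ.map S.out).window ℓ 0 = ζ.val}
  trans ζ u ζ' :=
    (ζ.val.append u ζ'.val.last).tail = ζ'.val ∧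
      ζ.val.append u ζ'.val.last ∈ lSeqs (ℓ + 1) D
  out ζ := ζ.val.last

/-- The relation between the states of `S` and those of its data-driven abstraction: `x` is
related to `ζ` when `ζ` is a corresponding external string of `x`. -/
def dataDrivenRel (S : TransitionSystem X U Y) {H : ℕ} (ℓ : ℕ) (D : Set (Behavior Y U H)) :
    Set (X × lSeqs ℓ D) :=
  {p | p.2.val ∈ S.ces ℓ H p.1}

/-- The internal behaviors of `Sb` under `u` from the initial states related to `x₀` by `R`. -/
def relatedInternalFrom (Sb : TransitionSystem Z U Y) (R : Set (X × Z)) {H : ℕ} (x₀ : X)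
    (u : Fin H → U) : Set (Behavior Z U H) :=
  ⋃ z₀ ∈ {z | (x₀, z) ∈ R} ∩ Sb.init, Sb.internalFrom z₀ u

/-- The pairs (initial state, input sequence) for which some internal behavior of `Sa` is not
related by `R`, at all times, to an internal behavior of `Sb` with the same external behavior. -/
def violationSet (Sa : TransitionSystem X U Y) (Sb : TransitionSystem Z U Y) (R : Set (X × Z))
    (H : ℕ) : Set (X × (Fin H → U)) :=
  {p | ∃ ξ ∈ Sa.internalFrom p.1 p.2, ¬ ∃ ξb ∈ Sb.relatedInternalFrom R p.1 p.2,
    ξ.map Sa.out = ξb.map Sb.out ∧ ∀ k : Fin (H + 1), (ξ.letter k, ξb.letter k) ∈ R}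

end TransitionSystem

/-- The complexity: the least number of elements of `D` that witness the same
`(ℓ + 1)`-sequences as the whole of `D`. -/
noncomputable def complexity {Y U : Type*} {H : ℕ} (ℓ : ℕ) (D : Set (Behavior Y U H)) : ℕ :=
  sInf {n | ∃ D' ⊆ D, D'.Finite ∧ D'.ncard = n ∧ lSeqs (ℓ + 1) D' = lSeqs (ℓ + 1) D}

/-- A deterministic system `x_{k+1} = f(x_k, u_k)`, `y_k = h(x_k)` with states in a Borel set
`X` of `ℝⁿ` and inputs in a finite set `U` in `ℝᵐ`; the value `f(x, u)` may lie outside `X`. -/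
structure ControlSystem (n m : ℕ) (Y : Type*) where
  X : Set (EuclideanSpace ℝ (Fin n))
  measurableSet_X : MeasurableSet X
  U : Set (EuclideanSpace ℝ (Fin m))
  finite_U : U.Finite
  f : X → U → EuclideanSpace ℝ (Fin n)
  measurable_f : ∀ u, Measurable fun x => f x u
  h : X → Y
  measurableSet_h : ∀ y, MeasurableSet (h ⁻¹' {y})

namespace ControlSystem

variable {n m : ℕ} {Y : Type*}

/-- The states together with the absorbing state `Sum.inr ()`. -/
abbrev State (P : ControlSystem n m Y) : Type := P.X ⊕ Unit

open Classical in
/-- One step of the system; trajectories that leave `X` go to the absorbing state. -/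
noncomputable def step (P : ControlSystem n m Y) : P.State → P.U → P.State
  | Sum.inl x, u => if hx : P.f x u ∈ P.X then Sum.inl ⟨P.f x u, hx⟩ else Sum.inr ()
  | Sum.inr _, _ => Sum.inr ()

/-- The system as a transition system: all states are initial, and the absorbing state has the
output label `Sum.inr ()` of its own. -/
noncomputable def toTS (P : ControlSystem n m Y) :
    TransitionSystem P.State P.U (Y ⊕ Unit) where
  init := Set.univ
  trans x u x' := x' = P.step x u
  out := Sum.map P.h id

end ControlSystem

/-- For `k < N` the polynomial equation for the scenario bound has exactly one solution. -/
theorem existsUnique_scenarioBound {k N : ℕ} {β : ℝ} (hk : k < N) (h₀ : 0 < β) (h₁ : β < 1) :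
    ∃! e : ℝ, (0 < e ∧ e < 1) ∧
      β / N * ∑ m ∈ Finset.Ico k N, (m.choose k : ℝ) * (1 - e) ^ (m - k) =
        (N.choose k : ℝ) * (1 - e) ^ (N - k) := by
  have hN : (0 : ℝ) < N := by exact_mod_cast (Nat.zero_le k).trans_lt hk
  have hC : (0 : ℝ) < (N.choose k : ℝ) := by exact_mod_cast Nat.choose_pos hk.le
  have hNk : N - k ≠ 0 := by omega
  set L : ℝ → ℝ := fun e =>
    β / N * ∑ m ∈ Finset.Ico k N, (m.choose k : ℝ) * (1 - e) ^ (m - k) with hL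
  set F : ℝ → ℝ := fun e => L e - (N.choose k : ℝ) * (1 - e) ^ (N - k) with hF
  have hcont : Continuous F := by
    simp only [hF, hL]
    fun_prop
  have hF0 : F 0 < 0 := by
    have h1 : ∑ m ∈ Finset.Ico k N, (m.choose k : ℝ) ≤ N * (N.choose k : ℝ) := by
      calc ∑ m ∈ Finset.Ico k N, (m.choose k : ℝ)
          ≤ ∑ _m ∈ Finset.Ico k N, (N.choose k : ℝ) := by
            refine Finset.sum_le_sum fun m hm => ?_
            exact_mod_cast Nat.choose_le_choose k (Finset.mem_Ico.1 hm).2.le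
        _ = ((N - k : ℕ) : ℝ) * (N.choose k : ℝ) := by simp
        _ ≤ N * (N.choose k : ℝ) := by
            gcongr
            exact Nat.sub_le N k
    have h2 : β / N * ∑ m ∈ Finset.Ico k N, (m.choose k : ℝ) ≤ β * (N.choose k : ℝ) := by
      calc β / N * ∑ m ∈ Finset.Ico k N, (m.choose k : ℝ)
          ≤ β / N * (N * (N.choose k : ℝ)) := by gcongr
        _ = β * (N.choose k : ℝ) := by field_simp
    simp only [hF, hL, sub_zero, one_pow, mul_one]
    nlinarith
  have hF1 : 0 < F 1 := by
    have h1 : ∑ m ∈ Finset.Ico k N, (m.choose k : ℝ) * (0 : ℝ) ^ (m - k) = 1 := by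
      rw [Finset.sum_eq_single k]
      · simp
      · intro m hm hmk
        have : m - k ≠ 0 := by have := (Finset.mem_Ico.1 hm).1; omega
        simp [this]
      · intro h
        exact absurd (Finset.mem_Ico.2 ⟨le_rfl, hk⟩) h
    simp only [hF, hL, sub_self, h1, zero_pow hNk, mul_zero, mul_one, sub_zero]
    positivity
  obtain ⟨e, he, hFe⟩ :=
    intermediate_value_Ioo (zero_le_one' ℝ) hcont.continuousOn (show (0 : ℝ) ∈ _ from ⟨hF0, hF1⟩)
  have key : ∀ a b : ℝ, 0 < a → b < 1 → a < b →
      L a = (N.choose k : ℝ) * (1 - a) ^ (N - k) →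
      L b = (N.choose k : ℝ) * (1 - b) ^ (N - k) → False := by
    intro a b ha hb hab hLa hLb
    have hs : 0 < 1 - b := by linarith
    have ht : 0 < 1 - a := by linarith
    have hlt : (1 - b) ^ (N - k) * L a < (1 - a) ^ (N - k) * L b := by
      simp only [hL, Finset.mul_sum]
      refine Finset.sum_lt_sum_of_nonempty ⟨k, Finset.mem_Ico.2 ⟨le_rfl, hk⟩⟩ fun m hm => ?_
      obtain ⟨hm1, hm2⟩ := Finset.mem_Ico.1 hm
      have hsplit : N - k = (m - k) + (N - m) := by omega
      have hp : (1 - b) ^ (N - m) < (1 - a) ^ (N - m) :=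
        pow_lt_pow_left₀ (by linarith) hs.le (by omega)
      have hmC : (0 : ℝ) < (m.choose k : ℝ) := by exact_mod_cast Nat.choose_pos hm1
      have hpos : 0 < β / N * (m.choose k : ℝ) * (1 - a) ^ (m - k) * (1 - b) ^ (m - k) := by
        positivity
      rw [hsplit, pow_add, pow_add]
      nlinarith [mul_lt_mul_of_pos_left hp hpos]
    rw [hLa, hLb] at hlt
    exact absurd hlt (by rw [not_lt]; exact le_of_eq (by ring))
  refine ⟨e, ⟨⟨he.1, he.2⟩, by simpa [hF, sub_eq_zero] using hFe⟩, ?_⟩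
  rintro e' ⟨⟨h0', h1'⟩, he'⟩
  have heq : L e = (N.choose k : ℝ) * (1 - e) ^ (N - k) := sub_eq_zero.1 hFe
  rcases lt_trichotomy e' e with h | h | h
  · exact (key e' e h0' he.2 h he' heq).elim
  · exact h
  · exact (key e e' he.1 h1' h heq he').elim

open Classical in
/-- The scenario bound `ε(k, β, N)`: the solution of the polynomial equation if `k < N`, and `1`
if `k = N`. -/
noncomputable def scenarioBound (k : ℕ) (β : ℝ) (N : ℕ) : ℝ :=
  if h : k < N ∧ 0 < β ∧ β < 1 then
    (existsUnique_scenarioBound h.1 h.2.1 h.2.2).choose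
  else 1

/-! The system is deterministic, so each sampled pair yields one external behavior, drawn from a
finite set with law `ν`. If all `(ℓ + 1)`-windows of a fresh behavior are witnessed in `D`, its
`ℓ`-windows form a run of the abstraction, and any run with the right output is automatically
related. Hence a violation forces an unseen window, and it suffices to bound the probability of
unseen features by sample compression.

Minimum covers need not be unique, so unit mass is spread evenly over them. For `I ⊆ J`, let `q J I`
be the expected mass of `I` among the minimum covers of `J`, restricted to samples where `I` misses
features of a fresh one with probability more than `ε(|I|)`. If `I` stays a minimum cover after a
sample joins `J`, that sample showed nothing new, an event of conditional probability at most `1 -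
ε(|I|)`, and the mass of `I` cannot grow (`coverWeight_insert_le`). So `q univ I ≤ (1 - ε(|I|)) ^ (N
- |J|) * q J I`.

Averaging over the `J ⊇ I` of each size `m < N` with the coefficients of the equation for `ε` gives
`∑ q univ I ≤ β` (`sum_le_of_scenario_decay`). The left side is the probability that the guarantee
on unseen features fails. -/

/-! ### Minimum covers and their uniform weights -/

section MinimumCovers

variable {Γ F ι : Type*} (A : Γ → Set F)

/-- The features seen along the samples with index in `I`. -/
def coverOf (γ : ι → Γ) (I : Finset ι) : Set F := ⋃ i ∈ I, A (γ i)

theorem coverOf_mono (γ : ι → Γ) {I J : Finset ι} (h : I ⊆ J) :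
    coverOf A γ I ⊆ coverOf A γ J :=
  Set.biUnion_subset_biUnion_left h

theorem subset_coverOf (γ : ι → Γ) {I : Finset ι} {i : ι} (h : i ∈ I) :
    A (γ i) ⊆ coverOf A γ I :=
  Set.subset_biUnion_of_mem (u := fun i => A (γ i)) h

open Classical in
/-- The index sets of least cardinality that see the same features as `J`. -/
noncomputable def minCovers (γ : ι → Γ) (J : Finset ι) : Finset (Finset ι) :=
  J.powerset.filter fun I => coverOf A γ I = coverOf A γ J ∧
    ∀ I' ⊆ J, coverOf A γ I' = coverOf A γ J → I.card ≤ I'.card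

theorem mem_minCovers {γ : ι → Γ} {I J : Finset ι} :
    I ∈ minCovers A γ J ↔ I ⊆ J ∧ coverOf A γ I = coverOf A γ J ∧
      ∀ I' ⊆ J, coverOf A γ I' = coverOf A γ J → I.card ≤ I'.card := by
  simp [minCovers]

theorem minCovers_nonempty (γ : ι → Γ) (J : Finset ι) : (minCovers A γ J).Nonempty := by
  classical
  obtain ⟨I, hI, hmin⟩ := Finset.exists_min_image
    (J.powerset.filter fun I => coverOf A γ I = coverOf A γ J) Finset.card
    ⟨J, by simp⟩
  simp only [Finset.mem_filter, Finset.mem_powerset] at hI hmin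
  exact ⟨I, (mem_minCovers A).2 ⟨hI.1, hI.2, fun I' h1 h2 => hmin I' ⟨h1, h2⟩⟩⟩

open Classical in
/-- The uniform distribution on the minimum covers of `J`. -/
noncomputable def coverWeight (γ : ι → Γ) (J I : Finset ι) : ENNReal :=
  if I ∈ minCovers A γ J then ((minCovers A γ J).card : ENNReal)⁻¹ else 0

theorem sum_coverWeight (γ : ι → Γ) (J : Finset ι) :
    ∑ I ∈ J.powerset, coverWeight A γ J I = 1 := by
  classical
  have hsub : minCovers A γ J ⊆ J.powerset := Finset.filter_subset _ _
  simp only [coverWeight]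
  rw [← Finset.sum_filter, Finset.filter_mem_eq_inter, Finset.inter_eq_right.2 hsub,
    Finset.sum_const, nsmul_eq_mul]
  refine ENNReal.mul_inv_cancel ?_ (ENNReal.natCast_ne_top _)
  exact_mod_cast (minCovers_nonempty A γ J).card_pos.ne'

variable [DecidableEq ι]

theorem coverOf_update (γ : ι → Γ) {I : Finset ι} {i : ι} (h : i ∉ I) (a : Γ) :
    coverOf A (Function.update γ i a) I = coverOf A γ I := by
  unfold coverOf
  refine Set.iUnion₂_congr fun j hj => ?_
  rw [Function.update_of_ne (by rintro rfl; exact h hj)]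

theorem minCovers_update (γ : ι → Γ) {J : Finset ι} {i : ι} (h : i ∉ J) (a : Γ) :
    minCovers A (Function.update γ i a) J = minCovers A γ J := by
  have key : ∀ I ⊆ J, coverOf A (Function.update γ i a) I = coverOf A γ I :=
    fun I hI => coverOf_update A γ (fun hi => h (hI hi)) a
  ext I
  simp only [mem_minCovers, key J subset_rfl]
  refine and_congr_right fun hI => ?_
  rw [key I hI]
  refine and_congr_right fun _ => forall₂_congr fun I' hI' => ?_
  rw [key I' hI']

theorem subset_coverOf_of_mem_minCovers_insert {γ : ι → Γ} {I J : Finset ι} {i : ι}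
    (h : I ∈ minCovers A γ (insert i J)) : A (γ i) ⊆ coverOf A γ I := by
  rw [((mem_minCovers A).1 h).2.1]
  exact subset_coverOf A γ (Finset.mem_insert_self i J)

/-- As `I ⊆ J` already sees everything, sample `i` adds no feature: both index sets have the same
target and the same least cover size `I.card`. -/
theorem minCovers_subset_insert {γ : ι → Γ} {I J : Finset ι} {i : ι} (hIJ : I ⊆ J)
    (h : I ∈ minCovers A γ (insert i J)) : minCovers A γ J ⊆ minCovers A γ (insert i J) ∧
      I ∈ minCovers A γ J := by
  obtain ⟨-, h2, h3⟩ := (mem_minCovers A).1 h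
  have hJ : coverOf A γ J = coverOf A γ (insert i J) :=
    (coverOf_mono A γ (Finset.subset_insert i J)).antisymm (h2 ▸ coverOf_mono A γ hIJ)
  refine ⟨fun K hK => ?_, (mem_minCovers A).2 ⟨hIJ, h2.trans hJ.symm, fun I' h1 h4 =>
    h3 I' (h1.trans (Finset.subset_insert i J)) (h4.trans hJ)⟩⟩
  obtain ⟨hK1, hK2, hK3⟩ := (mem_minCovers A).1 hK
  refine (mem_minCovers A).2 ⟨hK1.trans (Finset.subset_insert i J), hK2.trans hJ,
    fun I' h1 h4 => ?_⟩
  exact (hK3 I hIJ (h2.trans hJ.symm)).trans (h3 I' h1 h4)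

theorem coverWeight_update (γ : ι → Γ) {J : Finset ι} (I : Finset ι) {i : ι} (h : i ∉ J) (a : Γ) :
    coverWeight A (Function.update γ i a) J I = coverWeight A γ J I := by
  simp [coverWeight, minCovers_update A γ h]

/-- Adding `i` can only create further ties, so an equal share shrinks. The indicator records that
sample `i` brought nothing new. -/
theorem coverWeight_insert_le (γ : ι → Γ) {I J : Finset ι} {i : ι} (hIJ : I ⊆ J) :
    coverWeight A γ (insert i J) I ≤
      coverWeight A γ J I * {a | A a ⊆ coverOf A γ I}.indicator 1 (γ i) := by
  by_cases h : I ∈ minCovers A γ (insert i J)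
  · obtain ⟨h1, h2⟩ := minCovers_subset_insert A hIJ h
    rw [Set.indicator_of_mem (show γ i ∈ {a | A a ⊆ coverOf A γ I} from
      subset_coverOf_of_mem_minCovers_insert A h)]
    simp only [coverWeight, h, h2, if_true, Pi.one_apply, mul_one]
    exact ENNReal.inv_le_inv.2 (by exact_mod_cast Finset.card_le_card h1)
  · simp [coverWeight, h]

end MinimumCovers

/-! ### Integrating out one sample -/

section ResamplingOneCoordinate

variable {Γ ι : Type*} [Fintype ι] [DecidableEq ι] [Finite Γ] [MeasurableSpace Γ]
  [DiscreteMeasurableSpace Γ] (ν : Measure Γ) [IsProbabilityMeasure ν]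

/-- Integrate coordinate `i` first: `G` and `s` ignore it, so the inner integral is `G γ * ν (s γ)`.
The bound by `c` is needed only where `G` does not vanish, which lets `G` carry the riskiness
condition. -/
theorem lintegral_pi_mul_indicator_le (i : ι) (G : (ι → Γ) → ENNReal) (s : (ι → Γ) → Set Γ)
    (c : ENNReal) (hG : ∀ γ a, G (Function.update γ i a) = G γ)
    (hs : ∀ γ a, s (Function.update γ i a) = s γ) (hc : ∀ γ, G γ ≠ 0 → ν (s γ) ≤ c) :
    ∫⁻ γ, G γ * (s γ).indicator 1 (γ i) ∂(Measure.pi fun _ => ν) ≤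
      c * ∫⁻ γ, G γ ∂(Measure.pi fun _ => ν) := by
  rw [← lintegral_const_mul _ (.of_discrete)]
  by_cases hne : Nonempty (ι → Γ)
  swap
  · rw [not_nonempty_iff] at hne
    simp [lintegral_of_isEmpty]
  obtain ⟨γ₀⟩ := hne
  rw [lintegral_eq_lmarginal_univ γ₀, lintegral_eq_lmarginal_univ γ₀,
    ← Finset.insert_erase (Finset.mem_univ i),
    lmarginal_insert' _ .of_discrete (Finset.notMem_erase _ _),
    lmarginal_insert' _ .of_discrete (Finset.notMem_erase _ _)]
  refine lmarginal_mono (fun γ => ?_) γ₀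
  simp only [hG, hs, Function.update_self]
  rw [lintegral_const_mul _ .of_discrete, lintegral_indicator_one .of_discrete, lintegral_const,
    measure_univ, mul_one, mul_comm]
  by_cases h0 : G γ = 0
  · simp [h0]
  · gcongr
    exact hc γ h0

end ResamplingOneCoordinate

/-! ### Averaging against the scenario polynomial -/

/-- Supersets of `I` of size `m` correspond to `(m - |I|)`-subsets of its complement, via `J ↦ J \
I`. -/
theorem choose_mul_card_powersetCard_superset {N m : ℕ} (I : Finset (Fin N)) (hI : I.card ≤ m) :
    (N.choose I.card) * ((Finset.powersetCard m Finset.univ).filter (I ⊆ ·)).card =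
      N.choose m * m.choose I.card := by
  classical
  have : ((Finset.powersetCard m Finset.univ).filter (I ⊆ ·)).card =
      (N - I.card).choose (m - I.card) := by
    have hc : N - I.card = Iᶜ.card := by rw [Finset.card_compl, Fintype.card_fin]
    rw [hc, ← Finset.card_powersetCard]
    refine Finset.card_bij' (fun J _ => J \ I) (fun T _ => T ∪ I) ?_ ?_ ?_ ?_
    · intro J hJ
      simp only [Finset.mem_filter, Finset.mem_powersetCard] at hJ
      simp only [Finset.mem_powersetCard]
      refine ⟨fun x hx => by simpa using (Finset.mem_sdiff.1 hx).2, ?_⟩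
      rw [Finset.card_sdiff_of_subset hJ.2, hJ.1.2]
    · intro T hT
      simp only [Finset.mem_powersetCard] at hT
      have hd : Disjoint T I := by
        rw [Finset.disjoint_left]; intro x hx; simpa using hT.1 hx
      simp only [Finset.mem_filter, Finset.mem_powersetCard, Finset.card_union_of_disjoint hd, hT.2]
      exact ⟨⟨Finset.subset_univ _, by omega⟩, Finset.subset_union_right⟩
    · intro J hJ
      simp only [Finset.mem_filter] at hJ
      exact Finset.sdiff_union_of_subset hJ.2
    · intro T hT
      simp only [Finset.mem_powersetCard] at hT
      have hd : Disjoint T I := by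
        rw [Finset.disjoint_left]; intro x hx; simpa using hT.1 hx
      rw [Finset.union_sdiff_right, Finset.sdiff_eq_self_of_disjoint hd]
  rw [this, Nat.choose_mul hI]

theorem scenarioBound_spec {k N : ℕ} {β : ℝ} (hk : k < N) (h₀ : 0 < β) (h₁ : β < 1) :
    (0 < scenarioBound k β N ∧ scenarioBound k β N < 1) ∧
      β / N * ∑ m ∈ Finset.Ico k N, (m.choose k : ℝ) * (1 - scenarioBound k β N) ^ (m - k) =
        (N.choose k : ℝ) * (1 - scenarioBound k β N) ^ (N - k) := by
  rw [scenarioBound, dif_pos ⟨hk, h₀, h₁⟩]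
  exact (existsUnique_scenarioBound hk h₀ h₁).choose_spec.1

theorem scenarioBound_of_le {k N : ℕ} {β : ℝ} (hk : N ≤ k) : scenarioBound k β N = 1 := by
  rw [scenarioBound, dif_neg (by omega)]

/-- For fixed `I`, the decay averaged over all `J ⊇ I` of size `m` gives one inequality per `m`.
Weighted by `β / N`, their left sides add up, by the equation for `ε`, to a multiple of `a univ I`
that cancels. Summing over `I` then meets total mass at most `1` for each `J`, leaving `β / N` for
each of `N` sizes. -/
theorem sum_le_of_scenario_decay {N : ℕ} {β : ℝ} (h₀ : 0 < β) (h₁ : β < 1)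
    (a : Finset (Fin N) → Finset (Fin N) → ℝ) (ha : ∀ J I, 0 ≤ a J I)
    (hsum : ∀ J, ∑ I ∈ J.powerset, a J I ≤ 1)
    (hdecay : ∀ I J, I ⊆ J →
      a Finset.univ I ≤ (1 - scenarioBound I.card β N) ^ (N - J.card) * a J I)
    (htop : a Finset.univ Finset.univ = 0) :
    ∑ I : Finset (Fin N), a Finset.univ I ≤ β := by
  classical
  rcases Nat.eq_zero_or_pos N with rfl | hN
  · rw [Fintype.sum_eq_single Finset.univ (fun I hI => (hI (Subsingleton.elim _ _)).elim), htop]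
    exact h₀.le
  have hN' : (0 : ℝ) < N := by exact_mod_cast hN
  have key : ∀ I : Finset (Fin N), a Finset.univ I ≤ β / N * ∑ m ∈ Finset.range N,
      ((N.choose m : ℝ))⁻¹ *
        ∑ J ∈ Finset.powersetCard m Finset.univ, if I ⊆ J then a J I else 0 := by
    intro I
    have hnn : ∀ m, 0 ≤ ((N.choose m : ℝ))⁻¹ *
        ∑ J ∈ Finset.powersetCard m Finset.univ, (if I ⊆ J then a J I else 0) := fun m =>
      mul_nonneg (by positivity) (Finset.sum_nonneg fun J _ => by split_ifs <;> simp [ha])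
    rcases (Finset.card_le_univ I).lt_or_eq with hk | hk
    swap
    · rw [Finset.card_eq_iff_eq_univ] at hk
      rw [hk, htop]
      rw [hk] at hnn
      exact mul_nonneg (by positivity) (Finset.sum_nonneg fun m _ => hnn m)
    rw [Fintype.card_fin] at hk
    obtain ⟨⟨-, he1⟩, heq⟩ := scenarioBound_spec hk h₀ h₁
    set k := I.card
    set t := 1 - scenarioBound k β N
    have ht : 0 < t := by simp only [t]; linarith
    have hC : (0 : ℝ) < N.choose k := by exact_mod_cast Nat.choose_pos hk.le
    have hpow : 0 < t ^ (N - k) := by positivity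
    have hterm : ∀ m ∈ Finset.Ico k N, (m.choose k : ℝ) * t ^ (m - k) * a Finset.univ I ≤
        (N.choose k : ℝ) * t ^ (N - k) * (((N.choose m : ℝ))⁻¹ *
          ∑ J ∈ Finset.powersetCard m Finset.univ, if I ⊆ J then a J I else 0) := by
      intro m hm
      obtain ⟨hm1, hm2⟩ := Finset.mem_Ico.1 hm
      have hCm : (0 : ℝ) < N.choose m := by exact_mod_cast Nat.choose_pos hm2.le
      have hcount : (N.choose k : ℝ) *
          (((Finset.powersetCard m Finset.univ).filter (I ⊆ ·)).card : ℝ) =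
          N.choose m * m.choose k := by
        exact_mod_cast choose_mul_card_powersetCard_superset I hm1
      have hs : (((Finset.powersetCard m Finset.univ).filter (I ⊆ ·)).card : ℝ) *
          a Finset.univ I ≤ t ^ (N - m) *
          ∑ J ∈ Finset.powersetCard m Finset.univ, if I ⊆ J then a J I else 0 := by
        rw [← Finset.sum_filter, Finset.mul_sum, ← nsmul_eq_mul]
        refine Finset.card_nsmul_le_sum _ _ _ fun J hJ => ?_
        simp only [Finset.mem_filter, Finset.mem_powersetCard] at hJ
        have := hdecay I J hJ.2
        rwa [hJ.1.2] at this
      have hsplit : t ^ (N - k) = t ^ (m - k) * t ^ (N - m) := by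
        rw [← pow_add]; congr 1; omega
      have hmC : (m.choose k : ℝ) = ((N.choose m : ℝ))⁻¹ * (N.choose k *
          (((Finset.powersetCard m Finset.univ).filter (I ⊆ ·)).card : ℝ)) := by
        rw [hcount]; field_simp
      calc (m.choose k : ℝ) * t ^ (m - k) * a Finset.univ I
          = ((N.choose m : ℝ))⁻¹ * N.choose k * t ^ (m - k) *
            ((((Finset.powersetCard m Finset.univ).filter (I ⊆ ·)).card : ℝ) *
              a Finset.univ I) := by rw [hmC]; ring
        _ ≤ ((N.choose m : ℝ))⁻¹ * N.choose k * t ^ (m - k) * (t ^ (N - m) *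
          ∑ J ∈ Finset.powersetCard m Finset.univ, if I ⊆ J then a J I else 0) := by gcongr
        _ = _ := by rw [hsplit]; ring
    -- Multiplying by the right side of the equation for `ε` lets `heq` replace it by the sum over
    -- `m`.
    refine le_of_mul_le_mul_left ?_ (mul_pos hC hpow)
    calc (N.choose k : ℝ) * t ^ (N - k) * a Finset.univ I
        = β / N * ∑ m ∈ Finset.Ico k N, (m.choose k : ℝ) * t ^ (m - k) * a Finset.univ I := by
          rw [← heq, ← Finset.sum_mul]; ring
      _ ≤ β / N * ∑ m ∈ Finset.Ico k N, (N.choose k : ℝ) * t ^ (N - k) * (((N.choose m : ℝ))⁻¹ *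
          ∑ J ∈ Finset.powersetCard m Finset.univ, if I ⊆ J then a J I else 0) := by
          exact mul_le_mul_of_nonneg_left (Finset.sum_le_sum hterm) (by positivity)
      -- Sizes `m < k` are added so that the range no longer depends on `I` and the sums can be
      -- exchanged.
      _ ≤ β / N * ∑ m ∈ Finset.range N, (N.choose k : ℝ) * t ^ (N - k) * (((N.choose m : ℝ))⁻¹ *
          ∑ J ∈ Finset.powersetCard m Finset.univ, if I ⊆ J then a J I else 0) := by
          refine mul_le_mul_of_nonneg_left ?_ (by positivity)
          refine Finset.sum_le_sum_of_subset_of_nonneg (fun m hm => ?_) fun m _ _ =>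
            mul_nonneg (by positivity) (hnn m)
          exact Finset.mem_range.2 (Finset.mem_Ico.1 hm).2
      _ = _ := by rw [← Finset.mul_sum]; ring
  calc ∑ I : Finset (Fin N), a Finset.univ I
      ≤ ∑ I : Finset (Fin N), β / N * ∑ m ∈ Finset.range N, ((N.choose m : ℝ))⁻¹ *
        ∑ J ∈ Finset.powersetCard m Finset.univ, (if I ⊆ J then a J I else 0) :=
        Finset.sum_le_sum fun I _ => key I
    _ = β / N * ∑ m ∈ Finset.range N, ((N.choose m : ℝ))⁻¹ *
        ∑ J ∈ Finset.powersetCard m Finset.univ, ∑ I ∈ J.powerset, a J I := by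
        rw [← Finset.mul_sum, Finset.sum_comm]
        congr 1
        refine Finset.sum_congr rfl fun m _ => ?_
        rw [← Finset.mul_sum, Finset.sum_comm]
        congr 1
        refine Finset.sum_congr rfl fun J _ => ?_
        rw [← Finset.sum_filter]
        refine Finset.sum_congr ?_ fun _ _ => rfl
        ext I; simp
    _ ≤ β / N * ∑ m ∈ Finset.range N, (1 : ℝ) := by
        gcongr with m hm
        have hCm : (0 : ℝ) < N.choose m := by
          exact_mod_cast Nat.choose_pos (Finset.mem_range.1 hm).le
        rw [inv_mul_le_iff₀ hCm, mul_one]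
        refine (Finset.sum_le_card_nsmul _ _ 1 fun J _ => hsum J).trans ?_
        simp
    _ = β := by simp; field_simp

/-! ### The scenario bound on a finite sample space -/

section ScenarioBound

variable {Γ F : Type*} [Finite Γ] [MeasurableSpace Γ] [DiscreteMeasurableSpace Γ]
  (ν : Measure Γ) [IsProbabilityMeasure ν] (A : Γ → Set F)

/-- The samples along which the index set `I` fails to see the features of a fresh sample with
probability more than `e`. -/
def riskyCover {ι : Type*} (e : ℝ) (I : Finset ι) : Set (ι → Γ) :=
  {γ | e < ν.real {a | ¬ A a ⊆ coverOf A γ I}}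

/-- Riskiness of `I` and its weight in `J` do not depend on sample `i`; given both, that sample
stays inside the cover of `I` with probability at most `1 - e`. -/
theorem lintegral_coverWeight_insert_le {ι : Type*} [Fintype ι] [DecidableEq ι] (e : ℝ)
    {I J : Finset ι} {i : ι} (hi : i ∉ J) (hIJ : I ⊆ J) :
    ∫⁻ γ, coverWeight A γ (insert i J) I * (riskyCover ν A e I).indicator 1 γ
        ∂(Measure.pi fun _ => ν) ≤
      ENNReal.ofReal (1 - e) *
        ∫⁻ γ, coverWeight A γ J I * (riskyCover ν A e I).indicator 1 γ
          ∂(Measure.pi fun _ => ν) := by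
  have hiI : i ∉ I := fun h => hi (hIJ h)
  have hmem : ∀ γ a, Function.update γ i a ∈ riskyCover ν A e I ↔ γ ∈ riskyCover ν A e I := by
    intro γ a
    simp [riskyCover, coverOf_update A γ hiI]
  refine le_trans (lintegral_mono fun γ => ?_) (lintegral_pi_mul_indicator_le ν i
    (fun γ => coverWeight A γ J I * (riskyCover ν A e I).indicator 1 γ)
    (fun γ => {a | A a ⊆ coverOf A γ I}) (ENNReal.ofReal (1 - e)) ?_ ?_ ?_)
  · dsimp only
    rw [mul_right_comm]
    gcongr
    exact coverWeight_insert_le A γ hIJ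
  · intro γ a
    classical
    simp only [coverWeight_update A γ I hi, Set.indicator_apply, hmem, Pi.one_apply]
  · intro γ a
    simp only [coverOf_update A γ hiI]
  · intro γ hγ
    have hr : γ ∈ riskyCover ν A e I := by
      by_contra h
      simp [h] at hγ
    have hcompl : {a | ¬ A a ⊆ coverOf A γ I} = {a | A a ⊆ coverOf A γ I}ᶜ := rfl
    rw [riskyCover, Set.mem_ofPred_eq, hcompl, probReal_compl_eq_one_sub .of_discrete] at hr
    rw [← ofReal_measureReal]
    exact ENNReal.ofReal_le_ofReal (by linarith)

theorem lintegral_coverWeight_union_le {ι : Type*} [Fintype ι] [DecidableEq ι] (e : ℝ)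
    {I J : Finset ι} (hIJ : I ⊆ J) (T : Finset ι) (hT : Disjoint T J) :
    ∫⁻ γ, coverWeight A γ (T ∪ J) I * (riskyCover ν A e I).indicator 1 γ
        ∂(Measure.pi fun _ => ν) ≤
      ENNReal.ofReal (1 - e) ^ T.card *
        ∫⁻ γ, coverWeight A γ J I * (riskyCover ν A e I).indicator 1 γ
          ∂(Measure.pi fun _ => ν) := by
  induction T using Finset.induction_on with
  | empty => simp
  | insert i T hi ih =>
    rw [Finset.disjoint_insert_left] at hT
    rw [Finset.insert_union, Finset.card_insert_of_notMem hi, pow_succ', mul_assoc]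
    refine (lintegral_coverWeight_insert_le ν A e (by simp [hi, hT.1])
      (hIJ.trans Finset.subset_union_right)).trans ?_
    gcongr
    exact ih hT.2

/-- The scenario bound for samples from a finite space that are compressed to a smallest
subsample with the same set of features. -/
theorem measureReal_scenarioBound_lt_le {N : ℕ} {β : ℝ} (h₀ : 0 < β) (h₁ : β < 1)
    (s : (Fin N → Γ) → ℕ) (hs : ∀ γ, ∀ I ∈ minCovers A γ Finset.univ, I.card = s γ) :
    (Measure.pi fun _ : Fin N => ν).real
      {γ | scenarioBound (s γ) β N < ν.real {a | ¬ A a ⊆ coverOf A γ Finset.univ}} ≤ β := by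
  set R := {γ | scenarioBound (s γ) β N < ν.real {a | ¬ A a ⊆ coverOf A γ Finset.univ}} with hR
  set π := Measure.pi fun _ : Fin N => ν
  -- The probability that the cover of `J` picked uniformly at random is `I` and that `I` is risky
  -- at the level set by its own size.
  set q : Finset (Fin N) → Finset (Fin N) → ENNReal := fun J I =>
    ∫⁻ γ, coverWeight A γ J I *
      (riskyCover ν A (scenarioBound I.card β N) I).indicator 1 γ ∂π with hq
  have hqsum : ∀ J, ∑ I ∈ J.powerset, q J I ≤ 1 := by
    intro J
    calc ∑ I ∈ J.powerset, q J I
        ≤ ∑ I ∈ J.powerset, ∫⁻ γ, coverWeight A γ J I ∂π := by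
          refine Finset.sum_le_sum fun I _ => lintegral_mono fun γ => ?_
          refine mul_le_of_le_one_right' ?_
          exact Set.indicator_le_self' (fun _ _ => zero_le) γ
      _ = 1 := by
          rw [← lintegral_finsetSum _ fun _ _ => .of_discrete]
          simp [sum_coverWeight]
  -- All minimum covers of the full sample share the size `s γ` and the features seen, so their
  -- riskiness is exactly the event `R` and the weights sum out.
  have hqR : ∑ I : Finset (Fin N), q Finset.univ I = π R := by
    rw [← lintegral_finsetSum _ fun _ _ => .of_discrete,
      ← lintegral_indicator_one (MeasurableSet.of_discrete)]
    refine lintegral_congr fun γ => ?_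
    have hI : ∀ I ∈ (Finset.univ : Finset (Fin N)).powerset, coverWeight A γ Finset.univ I *
        (riskyCover ν A (scenarioBound I.card β N) I).indicator 1 γ =
        coverWeight A γ Finset.univ I * R.indicator 1 γ := by
      intro I _
      by_cases h : I ∈ minCovers A γ Finset.univ
      · congr 1
        have : γ ∈ riskyCover ν A (scenarioBound I.card β N) I ↔ γ ∈ R := by
          rw [riskyCover, Set.mem_ofPred_eq, hs γ I h, ((mem_minCovers A).1 h).2.1, hR,
            Set.mem_ofPred_eq]
        classical
        simp only [Set.indicator_apply, this]
      · simp [coverWeight, h]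
    rw [← Finset.powerset_univ, Finset.sum_congr rfl hI, ← Finset.sum_mul, sum_coverWeight,
      one_mul]
  have hqle : ∀ J I, I ⊆ J → q J I ≤ 1 := fun J I h =>
    (Finset.single_le_sum (f := q J) (fun _ _ => zero_le) (Finset.mem_powerset.2 h)).trans
      (hqsum J)
  have hq0 : ∀ J I, ¬ I ⊆ J → q J I = 0 := by
    intro J I h
    have : ∀ γ, I ∉ minCovers A γ J := fun γ h' => h ((mem_minCovers A).1 h').1
    simp [hq, coverWeight, this]
  have hqtop : ∀ J I, q J I ≠ ⊤ := by
    intro J I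
    by_cases h : I ⊆ J
    · exact ((hqle J I h).trans_lt ENNReal.one_lt_top).ne
    · simp [hq0 J I h]
  have hfin := sum_le_of_scenario_decay (N := N) h₀ h₁ (fun J I => (q J I).toReal)
    (fun _ _ => ENNReal.toReal_nonneg) ?_ ?_ ?_
  · rwa [← ENNReal.toReal_sum fun I _ => hqtop _ I, hqR] at hfin
  · intro J
    rw [← ENNReal.toReal_sum fun I _ => hqtop _ I]
    exact ENNReal.toReal_mono ENNReal.one_ne_top (hqsum J)
  · intro I J hIJ
    have he : 0 ≤ 1 - scenarioBound I.card β N := by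
      rcases lt_or_ge I.card N with h | h
      · linarith [(scenarioBound_spec h h₀ h₁).1.2]
      · rw [scenarioBound_of_le h, sub_self]
    have := lintegral_coverWeight_union_le ν A (scenarioBound I.card β N) hIJ Jᶜ
      disjoint_compl_left
    rw [Finset.union_comm, Finset.union_compl, Finset.card_compl, Fintype.card_fin] at this
    have h2 := ENNReal.toReal_mono
      (ENNReal.mul_ne_top (ENNReal.pow_ne_top ENNReal.ofReal_ne_top) (hqtop J I)) this
    rwa [ENNReal.toReal_mul, ENNReal.toReal_pow, ENNReal.toReal_ofReal he] at h2
  -- With all `N` indices in the cover the level is `1`, which no probability exceeds.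
  · have : riskyCover ν A (scenarioBound (Finset.univ : Finset (Fin N)).card β N)
        (Finset.univ : Finset (Fin N)) = ∅ := by
      rw [Finset.card_univ, Fintype.card_fin, scenarioBound_of_le le_rfl]
      ext γ
      simp [riskyCover]
    simp only [hq, this, Set.indicator_empty', Pi.zero_apply, mul_zero, lintegral_zero,
      ENNReal.toReal_zero]

end ScenarioBound

/-! ### Windows as features, and the complexity -/

section Windows

variable {Y U : Type*} {H : ℕ}

theorem Behavior.tail_window (γ : Behavior Y U H) (ℓ : ℕ) (k : Fin (H + 1)) :
    (γ.window (ℓ + 1) k).tail = γ.window ℓ k := by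
  simp only [Behavior.window, LSeq.tail, LSeq.mk.injEq, and_true]
  funext i
  have h1 : k.val + i.succ.val - (ℓ + 1) = k.val + i.val - ℓ := by simp; omega
  have h2 : ℓ + 1 ≤ k.val + i.succ.val ↔ ℓ ≤ k.val + i.val := by simp; omega
  simp only [h1, h2]

theorem Behavior.append_window (γ : Behavior Y U H) (ℓ : ℕ) (k : Fin H) :
    (γ.window ℓ k.castSucc).append (γ.input k) (γ.letter k.succ) = γ.window (ℓ + 1) k.succ := by
  simp only [Behavior.window, LSeq.append, LSeq.mk.injEq, and_true]
  funext i
  refine Fin.lastCases ?_ (fun i => ?_) i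
  · rw [Fin.snoc_last]
    have h1 : ℓ + 1 ≤ k.succ.val + (Fin.last ℓ).val := by simp
    have h2 : k.succ.val + (Fin.last ℓ).val - (ℓ + 1) = k.val := by simp; omega
    simp only [h1, h2, dif_pos]
    rfl
  · rw [Fin.snoc_castSucc]
    have h1 : k.succ.val + i.castSucc.val - (ℓ + 1) = k.castSucc.val + i.val - ℓ := by
      simp; omega
    have h2 : ℓ + 1 ≤ k.succ.val + i.castSucc.val ↔ ℓ ≤ k.castSucc.val + i.val := by
      simp; omega
    simp only [h1, h2]

theorem Behavior.window_zero_congr {γ γ' : Behavior Y U H} (ℓ : ℕ)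
    (h : γ.letter 0 = γ'.letter 0) : γ.window ℓ 0 = γ'.window ℓ 0 := by
  simp only [Behavior.window, LSeq.mk.injEq, h, and_true]
  funext i
  have : ¬ ℓ ≤ (0 : Fin (H + 1)).val + i.val := by simp
  rw [dif_neg this, dif_neg this]

theorem lSeqs_tail_mem {ℓ : ℕ} {D : Set (Behavior Y U H)} {γ : Behavior Y U H}
    {k : Fin (H + 1)} (h : γ.window (ℓ + 1) k ∈ lSeqs (ℓ + 1) D) : γ.window ℓ k ∈ lSeqs ℓ D := by
  obtain ⟨γ', hγ', k', h⟩ := h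
  exact ⟨γ', hγ', k', by rw [← γ'.tail_window, h, γ.tail_window]⟩

theorem lSeqs_eq_biUnion (ℓ : ℕ) (D : Set (Behavior Y U H)) :
    lSeqs ℓ D = ⋃ γ ∈ D, lSeqs ℓ {γ} := by
  ext ζ; simp [lSeqs]

theorem coverOf_lSeqs {ι : Type*} (ℓ : ℕ) (γ : ι → Behavior Y U H) (I : Finset ι) :
    coverOf (fun γ => lSeqs ℓ {γ}) γ I = lSeqs ℓ (γ '' I) := by
  rw [lSeqs_eq_biUnion, Set.biUnion_image]
  rfl

/-- Covers are sets of indices while the complexity counts distinct behaviors, and samples may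
repeat. One index per behavior turns a subset of the range into a cover no larger than itself;
conversely the image of a cover is no larger than the cover. -/
theorem card_eq_complexity {ι : Type*} [Fintype ι] {ℓ : ℕ} {γ : ι → Behavior Y U H}
    {I : Finset ι} (hI : I ∈ minCovers (fun γ => lSeqs (ℓ + 1) {γ}) γ Finset.univ) :
    I.card = complexity ℓ (Set.range γ) := by
  classical
  simp only [mem_minCovers, coverOf_lSeqs, Finset.coe_univ, Set.image_univ] at hI
  obtain ⟨-, h2, h3⟩ := hI
  have lower : ∀ D' ⊆ Set.range γ, D'.Finite → lSeqs (ℓ + 1) D' = lSeqs (ℓ + 1) (Set.range γ) →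
      I.card ≤ D'.ncard := by
    intro D' hD' hfin hD
    have hch : ∀ a : D', ∃ i, γ i = a := fun a => hD' a.2
    choose r hr using hch
    have := hfin.fintype
    have him : γ '' (Finset.univ.image r : Finset ι) = D' := by
      ext a
      simp only [Finset.coe_image, Finset.coe_univ, Set.image_univ, Set.mem_image, Set.mem_range]
      constructor
      · rintro ⟨_, ⟨a', rfl⟩, rfl⟩
        rw [hr]; exact a'.2
      · intro ha
        exact ⟨_, ⟨⟨a, ha⟩, rfl⟩, hr _⟩
    refine (h3 (Finset.univ.image r) (Finset.subset_univ _) (by rw [him, hD])).trans ?_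
    refine Finset.card_image_le.trans ?_
    rw [Finset.card_univ, ← Nat.card_eq_fintype_card]
    rfl
  have hle : (γ '' I).ncard ≤ I.card := by
    simpa using Set.ncard_image_le I.finite_toSet (f := γ)
  have hmem : I.card ∈ {n | ∃ D' ⊆ Set.range γ, D'.Finite ∧ D'.ncard = n ∧
      lSeqs (ℓ + 1) D' = lSeqs (ℓ + 1) (Set.range γ)} :=
    ⟨γ '' I, Set.image_subset_range _ _, I.finite_toSet.image _,
      -- Minimality rules out repeated behaviors within `I`.
      hle.antisymm (lower _ (Set.image_subset_range _ _) (I.finite_toSet.image _) h2), h2⟩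
  refine le_antisymm (le_csInf ⟨_, hmem⟩ ?_) (Nat.sInf_le hmem)
  rintro _ ⟨D', h, hf, rfl, hD⟩
  exact lower D' h hf hD

end Windows

/-! ### Runs of the abstraction -/

namespace TransitionSystem

variable {X U Y : Type*} (S : TransitionSystem X U Y) {H ℓ : ℕ} {D : Set (Behavior Y U H)}

/-- An internal behavior of the abstraction runs through the windows of its external behavior. -/
theorem dataDriven_letter_eq_window {ξb : Behavior (lSeqs ℓ D) U H}
    (h : ξb ∈ (S.dataDriven ℓ D).internal H) (k : Fin (H + 1)) :
    (ξb.letter k).val = (ξb.map (S.dataDriven ℓ D).out).window ℓ k := by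
  induction k using Fin.induction with
  | zero =>
    obtain ⟨ξ, -, hξ⟩ := h.1
    rw [← hξ]
    refine Behavior.window_zero_congr ℓ ?_
    exact congrArg LSeq.last hξ
  | succ k ih =>
    obtain ⟨h1, -⟩ := h.2 k
    rw [← h1, ih, ← Behavior.tail_window _ ℓ k.succ, ← Behavior.append_window]
    rfl

/-- The `ℓ`-windows of `γ` are themselves the run: consecutive ones overlap to form an `(ℓ +
1)`-window, which is the domino required by the transition. -/
theorem external_dataDriven_of_window_mem {γ : Behavior Y U H} (hγ : γ ∈ S.external H)
    (h : ∀ k, γ.window (ℓ + 1) k ∈ lSeqs (ℓ + 1) D) : γ ∈ (S.dataDriven ℓ D).external H := by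
  obtain ⟨ξ, hξ, rfl⟩ := hγ
  refine ⟨⟨fun k => ⟨(ξ.map S.out).window ℓ k, lSeqs_tail_mem (h k)⟩, ξ.input⟩,
    ⟨⟨ξ, hξ, rfl⟩, fun k => ?_⟩, rfl⟩
  have := (ξ.map S.out).append_window ℓ k
  refine ⟨?_, ?_⟩
  · change (((ξ.map S.out).window ℓ k.castSucc).append ((ξ.map S.out).input k)
      ((ξ.map S.out).letter k.succ)).tail = _
    rw [this, Behavior.tail_window]
  · change ((ξ.map S.out).window ℓ k.castSucc).append ((ξ.map S.out).input k)
      ((ξ.map S.out).letter k.succ) ∈ _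
    rw [this]
    exact h _

/-- The relation imposes nothing beyond equal outputs: a run of the abstraction consists of the
windows of its own output, so `ξ` itself witnesses that its states correspond to them. -/
theorem mem_violationSet_dataDriven {p : X × (Fin H → U)} :
    p ∈ S.violationSet (S.dataDriven ℓ D) (S.dataDrivenRel ℓ D) H ↔
      ∃ ξ ∈ S.internalFrom p.1 p.2, ξ.map S.out ∉ (S.dataDriven ℓ D).external H := by
  refine exists_congr fun ξ => and_congr_right fun hξ => not_congr ?_
  constructor
  · rintro ⟨ξb, hξb, hout, -⟩
    simp only [relatedInternalFrom, Set.mem_iUnion] at hξb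
    obtain ⟨_, _, h⟩ := hξb
    exact ⟨ξb, h.1, hout.symm⟩
  · rintro ⟨ξb, hξb, hout⟩
    have hrel : ∀ k, (ξ.letter k, ξb.letter k) ∈ S.dataDrivenRel ℓ D := by
      intro k
      have hw := S.dataDriven_letter_eq_window hξb k
      rw [hout] at hw
      exact ⟨⟨_, ⟨ξ, hξ.1, rfl⟩, k, hw.symm⟩, ξ, hξ.1, k, hw, rfl⟩
    refine ⟨ξb, ?_, hout.symm, hrel⟩
    simp only [relatedInternalFrom, Set.mem_iUnion]
    refine ⟨ξb.letter 0, ⟨?_, hξb.1⟩, hξb, rfl, ?_⟩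
    · have := hrel 0
      rwa [hξ.2.1] at this
    · have := congrArg Behavior.input hout
      exact this.trans hξ.2.2

end TransitionSystem

/-! ### Determinism and measurability of the concrete system -/

namespace ControlSystem

variable {n m : ℕ} {Y : Type*} (P : ControlSystem n m Y) {H : ℕ}

/-- The internal behavior from an initial state under an input sequence. -/
noncomputable def run (p : P.State × (Fin H → P.U)) : Behavior P.State P.U H :=
  ⟨Fin.induction p.1 fun i x => P.step x (p.2 i), p.2⟩

/-- The external behavior from an initial state under an input sequence. -/
noncomputable def response (p : P.State × (Fin H → P.U)) : Behavior (Y ⊕ Unit) P.U H :=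
  (P.run p).map P.toTS.out

theorem run_mem_internal (p : P.State × (Fin H → P.U)) : P.run p ∈ P.toTS.internal H :=
  ⟨trivial, fun _ => rfl⟩

theorem internalFrom_eq (p : P.State × (Fin H → P.U)) :
    P.toTS.internalFrom p.1 p.2 = {P.run p} := by
  ext ξ
  refine ⟨fun ⟨h1, h2, h3⟩ => ?_, ?_⟩
  · obtain ⟨letter, input⟩ := ξ
    dsimp only at h2 h3
    subst h3
    have : letter = (P.run p).letter := by
      funext k
      induction k using Fin.induction with
      | zero => exact h2
      | succ k ih => exact (h1.2 k).trans (by dsimp only; rw [ih]; rfl)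
    rw [this]
    rfl
  · rintro rfl
    exact ⟨P.run_mem_internal p, rfl, rfl⟩

theorem externalFrom_eq (p : P.State × (Fin H → P.U)) :
    P.toTS.externalFrom p.1 p.2 = {P.response p} := by
  ext γ
  simp only [TransitionSystem.externalFrom, internalFrom_eq, Set.mem_singleton_iff,
    exists_eq_left, Set.mem_ofPred_eq, response]
  refine ⟨fun h => h.2, fun h => ⟨?_, h⟩⟩
  exact ⟨_, P.run_mem_internal p, h.symm⟩

theorem sampledBehaviors_eq {N : ℕ} (ω : Fin N → P.State × (Fin H → P.U)) :
    P.toTS.sampledBehaviors ω = Set.range fun i => P.response (ω i) := by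
  simp only [TransitionSystem.sampledBehaviors, externalFrom_eq]
  exact Set.iUnion_singleton_eq_range _

theorem violationSet_dataDriven_eq (ℓ : ℕ) (D : Set (Behavior (Y ⊕ Unit) P.U H)) :
    P.toTS.violationSet (P.toTS.dataDriven ℓ D) (P.toTS.dataDrivenRel ℓ D) H =
      P.response ⁻¹' ((P.toTS.dataDriven ℓ D).external H)ᶜ := by
  ext p
  rw [TransitionSystem.mem_violationSet_dataDriven, internalFrom_eq]
  simp [response]

theorem measurable_step : Measurable fun q : P.State × P.U => P.step q.1 q.2 := by
  have := P.finite_U.to_subtype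
  refine measurable_from_prod_countable_left fun u => measurable_fun_sum ?_ ?_
  · have hs : MeasurableSet {x : P.X | P.f x u ∈ P.X} := P.measurable_f u P.measurableSet_X
    classical
    refine Measurable.dite (s := {x : P.X | P.f x u ∈ P.X})
      (f := fun x => (Sum.inl ⟨P.f x.1 u, x.2⟩ : P.State)) (g := fun _ => Sum.inr ()) ?_ ?_ hs
    · exact measurable_inl.comp
        (((P.measurable_f u).comp measurable_subtype_coe).subtype_mk)
    · exact measurable_const
  · exact measurable_const

theorem measurable_run_letter (k : Fin (H + 1)) :
    Measurable fun p : P.State × (Fin H → P.U) => (P.run p).letter k := by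
  induction k using Fin.induction with
  | zero => exact measurable_fst
  | succ k ih =>
    exact P.measurable_step.comp (ih.prodMk ((measurable_pi_apply k).comp measurable_snd))

theorem measurableSet_out_preimage (y : Y ⊕ Unit) : MeasurableSet (P.toTS.out ⁻¹' {y}) := by
  rw [measurableSet_sum_iff]
  rcases y with y | y
  · refine ⟨?_, ?_⟩
    · convert P.measurableSet_h y using 1
      ext x
      simp [toTS]
    · convert MeasurableSet.empty
      ext x
      simp [toTS]
  · refine ⟨?_, MeasurableSet.of_discrete⟩
    convert MeasurableSet.empty
    ext x
    simp [toTS]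

theorem measurableSet_response_preimage (γ : Behavior (Y ⊕ Unit) P.U H) :
    MeasurableSet (P.response ⁻¹' {γ}) := by
  have : P.response ⁻¹' {γ} = (⋂ k, (fun p => (P.run p).letter k) ⁻¹'
      (P.toTS.out ⁻¹' {γ.letter k})) ∩ Prod.snd ⁻¹' {γ.input} := by
    ext p
    obtain ⟨letter, input⟩ := γ
    simp [response, Behavior.map, funext_iff, run]
  rw [this]
  exact (MeasurableSet.iInter fun k =>
    P.measurable_run_letter k (P.measurableSet_out_preimage _)).inter
    (measurable_snd (measurableSet_singleton _))

end ControlSystem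

/-! ### Transfer to the finite space of behaviors -/

theorem Behavior.finite {A U : Type*} {H : ℕ} [Finite A] [Finite U] : Finite (Behavior A U H) :=
  Finite.of_injective (fun γ => (γ.letter, γ.input)) fun γ γ' h => by
    cases γ; cases γ'; simpa using h

theorem mainTheorem3 {n m : ℕ} {Y : Type*} [Finite Y] (P : ControlSystem n m Y)
    (N H ℓ : ℕ) (hℓ : ℓ < H)
    (μx : Measure P.State) [IsProbabilityMeasure μx]
    (μu : Measure (Fin H → P.U)) [IsProbabilityMeasure μu]
    (β : ℝ) (hβ₀ : 0 < β) (hβ₁ : β < 1) :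
    let S := P.toTS
    let μp : Measure (P.State × (Fin H → P.U)) := μx.prod μu
    -- the violation set of the abstraction built from the samples `ω`
    let V : (Fin N → P.State × (Fin H → P.U)) → Set (P.State × (Fin H → P.U)) := fun ω =>
      S.violationSet (S.dataDriven ℓ (S.sampledBehaviors ω))
        (S.dataDrivenRel ℓ (S.sampledBehaviors ω)) H
    -- the event that the guarantee holds
    let E : Set (Fin N → P.State × (Fin H → P.U)) :=
      {ω | μp.real (V ω) ≤ scenarioBound (complexity ℓ (S.sampledBehaviors ω)) β N}
    (∀ ω, MeasurableSet (V ω)) ∧ MeasurableSet E ∧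
      1 - β ≤ (Measure.pi fun _ : Fin N => μp).real E := by
  intro S μp V E
  have := P.finite_U.to_subtype
  have : Finite (Behavior (Y ⊕ Unit) P.U H) := Behavior.finite
  let : MeasurableSpace (Behavior (Y ⊕ Unit) P.U H) := ⊤
  have : DiscreteMeasurableSpace (Behavior (Y ⊕ Unit) P.U H) := ⟨fun _ => trivial⟩
  have hb : Measurable (P.response (H := H)) :=
    measurable_to_countable' P.measurableSet_response_preimage
  set ν := μp.map P.response with hν
  have : IsProbabilityMeasure ν := Measure.isProbabilityMeasure_map hb.aemeasurable
  have hB : Measurable fun (ω : Fin N → P.State × (Fin H → P.U)) i => P.response (ω i) :=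
    measurable_pi_lambda _ fun i => hb.comp (measurable_pi_apply i)
  have hV : ∀ ω, V ω = P.response ⁻¹'
      ((S.dataDriven ℓ (Set.range fun i => P.response (ω i))).external H)ᶜ := by
    intro ω
    rw [← P.sampledBehaviors_eq ω]
    exact P.violationSet_dataDriven_eq ℓ _
  have hE : E = (fun ω i => P.response (ω i)) ⁻¹' {γ | ν.real
      ((S.dataDriven ℓ (Set.range γ)).external H)ᶜ ≤
        scenarioBound (complexity ℓ (Set.range γ)) β N} := by
    ext ω
    simp only [E, Set.mem_ofPred_eq, Set.mem_preimage, hV, P.sampledBehaviors_eq ω, S]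
    rw [hν, map_measureReal_apply hb .of_discrete]
  have hEm : MeasurableSet E := hE ▸ hB .of_discrete
  refine ⟨fun ω => hV ω ▸ hb .of_discrete, hEm, ?_⟩
  have hbad := measureReal_scenarioBound_lt_le ν (fun γ => lSeqs (ℓ + 1) {γ}) hβ₀ hβ₁
    (fun γ : Fin N → _ => complexity ℓ (Set.range γ)) fun γ I hI => card_eq_complexity hI
  -- Independent samples have independent responses: the product of the laws `ν` is the image of the
  -- product of the `μp`.
  rw [hν, ← Measure.pi_map_pi fun _ => hb.aemeasurable, ← hν,
    map_measureReal_apply hB .of_discrete] at hbad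
  have hc := probReal_compl_eq_one_sub (μ := Measure.pi fun _ : Fin N => μp) hEm
  have hle : (Measure.pi fun _ : Fin N => μp).real Eᶜ ≤ β := by
    refine (measureReal_mono fun ω hω => ?_).trans hbad
    simp only [E, Set.mem_compl_iff, Set.mem_ofPred_eq, not_le] at hω
    simp only [Set.mem_preimage, Set.mem_ofPred_eq]
    rw [← P.sampledBehaviors_eq ω]
    refine hω.trans_le ?_
    rw [hν, map_measureReal_apply hb .of_discrete, hV, coverOf_lSeqs, Finset.coe_univ,
      Set.image_univ]
    -- A violating pair must show an unseen `(ℓ + 1)`-window; otherwise its response would be a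
    -- behavior of the abstraction.
    refine measureReal_mono fun p hp hsub => hp ?_
    refine S.external_dataDriven_of_window_mem ⟨_, P.run_mem_internal p, rfl⟩ fun k => ?_
    exact hsub ⟨_, rfl, k, rfl⟩
  linarith
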